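/- Throughout, $\|\cdot\|$ is the Euclidean norm, and functions are "implemented by circuits" if they are computed by arithmetic circuits with input gates, rational constants and the operations $+$, $\ast$, $\max$ and multiplication by a rational constant (well-behaved: at most $\log_2(\mathrm{size})$ multiplication gates on any path to an output). *Problems.* (a) Let $f:[0,1]^d\times[0,1]^d\to[-B,B]$ be $G$-Lipschitz with $L$-Lipschitz gradient, $f$ and $\nabla f$ implemented by circuits, and let $g_i(x,y)=\max_{j\in[m]}h^{(i)}_j(x,y)$, $i\in\{1,2\}$, $m\ge 1$, take values in $[-1,1]$ on $[0,1]^d\times[0,1]^d$, where each $h^{(i)}_j$ has the form $x^\top By+b_1^\top x+b_2^\top y+c$. For $\nu\ge0$ put $K_1^\nu(y)=\{x\in[0,1]^d:g_1(x,y)\le\nu\}$ and $K_2^\nu(x)=\{y\in[0,1]^d:g_2(x,y)\le\nu\}$; assume that $K_1^0(y)$ and $K_2^0(x)$ are nonempty for all $x,y\in[0,1]^d$. A solution of **LR-LocalMinMax** with parameters $\epsilon,\delta>0$, $\delta<\sqrt{2\epsilon/L}$, $\nu\ge0$ is a pair $(x^\star,y^\star)\in[0,1]^d\times[0,1]^d$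 with $g_1(x^\star,y^\star)\le\nu$, $g_2(x^\star,y^\star)\le\nu$, $f(x^\star,y^\star)\le f(x,y^\star)+\epsilon$ for all $x\in K_1^\nu(y^\star)$ with $\|x-x^\star\|\le\delta$, and $f(x^\star,y^\star)\ge f(x^\star,y)-\epsilon$ for all $y\in K_2^\nu(x^\star)$ with $\|y-y^\star\|\le\delta$. A solution of **GDAFixedPoint** with parameters $\alpha,\nu\ge0$ is a pair $(x^\star,y^\star)\in[0,1]^d\times[0,1]^d$ with $g_i(x^\star,y^\star)\le\nu$ for $i\in\{1,2\}$ and $\|(x^\star,y^\star)-F(x^\star,y^\star)\|\le\alpha$, where $F(x,y)=\big(\Pi_{K_1^\nu(y)}(x-\nabla_xf(x,y)),\,\Pi_{K_2^\nu(x)}(y+\nabla_yf(x,y))\big)$ and $\Pi_K$ is the Euclidean projection onto $K$. (b) Let $A:[0,1]^d\to\mathbb R^{n\times d}$ and $b:[0,1]^d\to\mathbb R^n$ be $L$-Lipschitz (for $A$ this means that $w\mapsto A(w)z$ is $L$-Lipschitz for every $z\in[0,1]^d$), let $Q_\nu(w)=\{z\in[0,1]^d:A(w)z\le b(w)+\nu\mathbf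 1\}$, and assume that $Q_0(w)\ne\emptyset$ for all $w\in[0,1]^d$. A solution of **Kakutani** is a point $z\in[0,1]^d$ with $z\in Q_\nu(z)$. For a Lipschitz $F:\mathbb R^d\to\mathbb R^d$, a solution of **QuasiVI** is a point $z\in Q_\nu(z)$ with $F(z)^\top(z'-z)\ge-\epsilon$ for all $z'\in Q_\nu(z)$. **Proposition.** 1. With $\nu=0$, QuasiVI, LR-LocalMinMax and GDAFixedPoint need not have solutions. Explicitly, let $d=1$, $f(x,y)=1-x$, $g_1(x,y)=xy$, $g_2(x,y)=\max(x-y,\,y-x)$, with $G=L=B=1$. This instance satisfies all the assumptions in (a), and - whenever $0<\epsilon<1$ and $\epsilon<\delta<\sqrt{2\epsilon}$ (for instance $\delta=\tfrac54\epsilon$), LR-LocalMinMax has no solution with $\nu=0$; - whenever $0\le\alpha<1$, GDAFixedPoint has no solution with $\nu=0$; - the associated QuasiVI on $[0,1]^2$, with $F\equiv(-1,0)=(\nabla_xf,-\nabla_yf)$ and $Q_0(x,y)=\{(x',y')\in[0,1]^2: yx'\le0,\ y'\le x,\ -y'\le-x\}$, satisfies the assumptions in (b), its data are implemented by circuits,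 and it has no solution with $\nu=0$ for any $0<\epsilon<1$. 2. Kakutani always has a solution, for all $d,n$, all $A,b$ as in (b) (implemented by circuits or not) and every $\nu\ge0$, in particular for $\nu=0$. It may have only irrational ones: for $d=2$, $n=4$ and the circuit-implemented data $$A(x,y)=\begin{pmatrix}1&0\\-1&0\\0&\max(x,\frac12)\\0&-\max(x,\frac12)\end{pmatrix},\qquad b(x,y)=\begin{pmatrix}y\\-y\\\frac12\\-\frac12\end{pmatrix},$$ the assumptions in (b) hold and, with $\nu=0$, the only solution is $z=(1/\sqrt2,1/\sqrt2)$, which is irrational. -/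

import Mathlib

open scoped NNReal Matrix

namespace CoupledMinMax

/-! ### Spaces -/

/-- `ℝ^d` with the Euclidean norm. -/
abbrev E (d : ℕ) : Type := EuclideanSpace ℝ (Fin d)

/-- `ℝ^d × ℝ^d = ℝ^(2d)` with the Euclidean norm; a point is a pair `(x, y)` of strategies. -/
abbrev P (d : ℕ) : Type := WithLp 2 (E d × E d)

/-- The pair `(x, y)` as a point of `ℝ^(2d)`. -/
def pair {d : ℕ} (x y : E d) : P d := WithLp.toLp 2 (x, y)

/-- The hypercube `[0,1]^d`. -/
def cube (d : ℕ) : Set (E d) := {z | ∀ i, 0 ≤ z i ∧ z i ≤ 1}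

/-- The hypercube `[0,1]^(2d) = [0,1]^d × [0,1]^d`. -/
def box (d : ℕ) : Set (P d) := {p | p.fst ∈ cube d ∧ p.snd ∈ cube d}

/-! ### Arithmetic circuits -/

/-- A gate with inputs labelled by `ι` that may read the values of `k` earlier gates. -/
inductive Gate (ι : Type) (k : ℕ) : Type
  | input (i : ι) : Gate ι k
  | const (c : ℚ) : Gate ι k
  | add (a b : Fin k) : Gate ι k
  | mul (a b : Fin k) : Gate ι k
  | max (a b : Fin k) : Gate ι k
  | scale (c : ℚ) (a : Fin k) : Gate ι k

/-- An arithmetic circuit with `k` gates: a directed acyclic graph whose nodes are listed in a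
topological order, so that each gate only reads earlier gates. -/
inductive Circuit (ι : Type) : ℕ → Type
  | nil : Circuit ι 0
  | snoc {k : ℕ} (C : Circuit ι k) (g : Gate ι k) : Circuit ι (k + 1)

/-- The value of a gate, given the inputs `x` and the values `v` of the earlier gates. -/
noncomputable def Gate.eval {ι : Type} {k : ℕ} (x : ι → ℝ) (v : Fin k → ℝ) : Gate ι k → ℝ
  | .input i => x i
  | .const c => (c : ℝ)
  | .add a b => v a + v b
  | .mul a b => v a * v b
  | .max a b => Max.max (v a) (v b)
  | .scale c a => (c : ℝ) * v a

/-- The values of all gates of a circuit on the input `x`. -/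
noncomputable def Circuit.eval {ι : Type} (x : ι → ℝ) : {k : ℕ} → Circuit ι k → Fin k → ℝ
  | _, .nil => Fin.elim0
  | _, .snoc C g => Fin.snoc (α := fun _ => ℝ) (C.eval x) (g.eval x (C.eval x))

/-- The largest number of multiplication gates on a directed path that ends in a gate, given
these numbers `v` for the earlier gates. -/
def Gate.mulDepth {ι : Type} {k : ℕ} (v : Fin k → ℕ) : Gate ι k → ℕ
  | .input _ => 0
  | .const _ => 0
  | .add a b => Max.max (v a) (v b)
  | .mul a b => Max.max (v a) (v b) + 1
  | .max a b => Max.max (v a) (v b)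
  | .scale _ a => v a

/-- For each gate, the largest number of multiplication gates on a directed path ending in it. -/
def Circuit.mulDepth {ι : Type} : {k : ℕ} → Circuit ι k → Fin k → ℕ
  | _, .nil => Fin.elim0
  | _, .snoc C g => Fin.snoc (α := fun _ => ℕ) C.mulDepth (g.mulDepth C.mulDepth)

/-- On the set `S`, the function `φ` is implemented by a well-behaved arithmetic circuit: no
directed path that leads to an output has more than `log₂` of the size many multiplication gates.
The size is taken to be the number `k` of gates, which is at most the bit size. -/
def CircuitComputable {X ι κ : Type} (coord : X → ι → ℝ) (S : Set X) (φ : X → κ → ℝ) : Prop :=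
  ∃ (k : ℕ) (C : Circuit ι k) (out : κ → Fin k),
    (∀ j, C.mulDepth (out j) ≤ Nat.log 2 k) ∧
    ∀ x ∈ S, ∀ j, C.eval (coord x) (out j) = φ x j

/-- The coordinates of a point of `ℝ^d`. -/
def coords {d : ℕ} (z : E d) : Fin d → ℝ := fun i => z i

/-- The coordinates of a point of `ℝ^(2d)`. -/
def pairCoords {d : ℕ} (p : P d) : Fin d ⊕ Fin d → ℝ := Sum.elim (coords p.fst) (coords p.snd)

/-! ### Local min-max with bilinear constraints -/

/-- The coefficients of a function `h(x,y) = xᵀ B y + b₁ᵀ x + b₂ᵀ y + c`. -/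
structure BilinearFn (d : ℕ) where
  B : Matrix (Fin d) (Fin d) ℝ
  b₁ : Fin d → ℝ
  b₂ : Fin d → ℝ
  c : ℝ

/-- `h(x,y) = xᵀ B y + b₁ᵀ x + b₂ᵀ y + c`. -/
def BilinearFn.eval {d : ℕ} (h : BilinearFn d) (x y : E d) : ℝ :=
  coords x ⬝ᵥ (h.B *ᵥ coords y) + h.b₁ ⬝ᵥ coords x + h.b₂ ⬝ᵥ coords y + h.c

/-- `max_j h_j(x,y)`. -/
noncomputable def maxEval {d m : ℕ} [NeZero m] (h : Fin m → BilinearFn d) (x y : E d) : ℝ :=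
  Finset.univ.sup' Finset.univ_nonempty fun j => (h j).eval x y

/-- The data shared by the local min-max problem and the gradient descent-ascent problem:
the payoff `f`, its gradient, the `m` bilinear functions defining the constraint of either player,
the Lipschitz constant `G`, the smoothness constant `L` and the bound `B`. -/
structure MinMaxInstance (d m : ℕ) where
  f : P d → ℝ
  grad : P d → P d
  h₁ : Fin m → BilinearFn d
  h₂ : Fin m → BilinearFn d
  G : ℝ≥0
  L : ℝ≥0
  B : ℝ≥0

namespace MinMaxInstance

variable {d m : ℕ} [NeZero m] (I : MinMaxInstance d m)

/-- The constraint function of the minimizing player. -/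
noncomputable def g₁ (x y : E d) : ℝ := maxEval I.h₁ x y

/-- The constraint function of the maximizing player. -/
noncomputable def g₂ (x y : E d) : ℝ := maxEval I.h₂ x y

/-- `K₁^ν(y)`: the feasible strategies of the minimizing player against `y`. -/
def K₁ (ν : ℝ) (y : E d) : Set (E d) := {x | x ∈ cube d ∧ I.g₁ x y ≤ ν}

/-- `K₂^ν(x)`: the feasible strategies of the maximizing player against `x`. -/
def K₂ (ν : ℝ) (x : E d) : Set (E d) := {y | y ∈ cube d ∧ I.g₂ x y ≤ ν}

/-- The promises on an instance. -/
structure IsValid : Prop where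
  bounded : ∀ p ∈ box d, |I.f p| ≤ I.B
  hasGradient : ∀ p ∈ box d, HasGradientWithinAt I.f (I.grad p) (box d) p
  lipschitz : LipschitzOnWith I.G I.f (box d)
  smooth : LipschitzOnWith I.L I.grad (box d)
  f_circuit : CircuitComputable pairCoords (box d) fun p (_ : Unit) => I.f p
  grad_circuit : CircuitComputable pairCoords (box d) fun p => pairCoords (I.grad p)
  g₁_range : ∀ x ∈ cube d, ∀ y ∈ cube d, |I.g₁ x y| ≤ 1
  g₂_range : ∀ x ∈ cube d, ∀ y ∈ cube d, |I.g₂ x y| ≤ 1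
  K₁_nonempty : ∀ y ∈ cube d, (I.K₁ 0 y).Nonempty
  K₂_nonempty : ∀ x ∈ cube d, (I.K₂ 0 x).Nonempty

/-- The local regime: `0 < ε`, `0 < δ < √(2ε/L)`. -/
def LocalRegime (ε δ : ℝ) : Prop := 0 < ε ∧ 0 < δ ∧ δ < √(2 * ε / I.L)

/-- `(x,y)` is an `(ε,δ,ν)`-solution of the local min-max problem. -/
def IsLocalMinMax (ε δ ν : ℝ) (x y : E d) : Prop :=
  x ∈ cube d ∧ y ∈ cube d ∧ I.g₁ x y ≤ ν ∧ I.g₂ x y ≤ ν ∧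
  (∀ x' ∈ cube d, ‖x' - x‖ ≤ δ → I.g₁ x' y ≤ ν → I.f (pair x y) ≤ I.f (pair x' y) + ε) ∧
  (∀ y' ∈ cube d, ‖y' - y‖ ≤ δ → I.g₂ x y' ≤ ν → I.f (pair x y) ≥ I.f (pair x y') - ε)

end MinMaxInstance

/-- `p` is a point of `K` nearest to `u`. -/
def IsNearest {d : ℕ} (K : Set (E d)) (u p : E d) : Prop :=
  p ∈ K ∧ ∀ q ∈ K, ‖u - p‖ ≤ ‖u - q‖

open Classical in
/-- The Euclidean projection `Π_K(u)`: the nearest point of `K`, which exists and is unique when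
`K` is nonempty, closed and convex (an arbitrary nearest point, or `u`, otherwise). -/
noncomputable def proj {d : ℕ} (K : Set (E d)) (u : E d) : E d :=
  if h : ∃ p, IsNearest K u p then h.choose else u

namespace MinMaxInstance

variable {d m : ℕ} [NeZero m] (I : MinMaxInstance d m)

/-- The gradient descent-ascent map
`(x,y) ↦ (Π_{K₁^ν(y)}(x - ∇ₓf(x,y)), Π_{K₂^ν(x)}(y + ∇_yf(x,y)))`. -/
noncomputable def gda (ν : ℝ) (x y : E d) : P d :=
  pair (proj (I.K₁ ν y) (x - (I.grad (pair x y)).fst))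
    (proj (I.K₂ ν x) (y + (I.grad (pair x y)).snd))

/-- `(x,y)` is a feasible `α`-approximate fixed point of the gradient descent-ascent map. -/
def IsGDAFixedPoint (α ν : ℝ) (x y : E d) : Prop :=
  x ∈ cube d ∧ y ∈ cube d ∧ I.g₁ x y ≤ ν ∧ I.g₂ x y ≤ ν ∧ ‖pair x y - I.gda ν x y‖ ≤ α

end MinMaxInstance

/-! ### Polytope correspondences -/

/-- A matrix-valued map `A` and a vector-valued map `b` on `[0,1]^d` (their values outside the
cube are irrelevant), with a Lipschitz constant `L`. -/
structure PolytopeMap (d n : ℕ) where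
  A : E d → Matrix (Fin n) (Fin d) ℝ
  b : E d → E n
  L : ℝ≥0

namespace PolytopeMap

variable {d n : ℕ} (R : PolytopeMap d n)

/-- `Q_ν(w) = {z ∈ [0,1]^d : A(w) z ≤ b(w) + ν 1}`. -/
def Q (ν : ℝ) (w : E d) : Set (E d) :=
  {z | z ∈ cube d ∧ ∀ i, (R.A w *ᵥ coords z) i ≤ R.b w i + ν}

/-- `A` and `b` are `L`-Lipschitz on the cube (for `A`: each map `w ↦ A(w) z` with `z` in the cube
is), and every `Q(w) = Q_0(w)` is nonempty. -/
structure IsValid : Prop where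
  lipschitz_A : ∀ z ∈ cube d,
    LipschitzOnWith R.L (fun w => (WithLp.toLp 2 (R.A w *ᵥ coords z) : E n)) (cube d)
  lipschitz_b : LipschitzOnWith R.L R.b (cube d)
  nonempty : ∀ w ∈ cube d, (R.Q 0 w).Nonempty

/-- `A` and `b` are implemented by arithmetic circuits. -/
def HasCircuits : Prop :=
  CircuitComputable coords (cube d) (fun w (ij : Fin n × Fin d) => R.A w ij.1 ij.2) ∧
  CircuitComputable coords (cube d) (fun w => coords (R.b w))

/-- `z` solves the Kakutani problem: `z ∈ Q_ν(z)`. -/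
def IsKakutaniSolution (ν : ℝ) (z : E d) : Prop := z ∈ cube d ∧ z ∈ R.Q ν z

/-- `z` solves the quasi-variational inequality with operator `F` up to `ε`. -/
def IsQuasiVISolution (F : E d → E d) (ε ν : ℝ) (z : E d) : Prop :=
  z ∈ cube d ∧ z ∈ R.Q ν z ∧ ∀ z' ∈ R.Q ν z, inner ℝ (F z) (z' - z) ≥ -ε

end PolytopeMap

/-! ### The explicit instances -/

/-- `d = 1`, `f(x,y) = 1 - x`, the minimizing player `x` is constrained by `x y ≤ 0`, the
maximizing player `y` by `max (x - y) (y - x) ≤ 0`. -/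
noncomputable def noSolutionInstance : MinMaxInstance 1 2 where
  f := fun p => 1 - p.fst 0
  grad := fun _ => pair (!₂[-1]) (!₂[0])
  h₁ := ![⟨!![1], ![0], ![0], 0⟩, ⟨!![1], ![0], ![0], 0⟩]
  h₂ := ![⟨!![0], ![1], ![-1], 0⟩, ⟨!![0], ![-1], ![1], 0⟩]
  G := 1
  L := 1
  B := 1

/-- The correspondence `Q(x,y) = K₁(y) × K₂(x)` of `noSolutionInstance`, that is
`Q(x,y) = {(x',y') ∈ [0,1]² : y x' ≤ 0, y' ≤ x, -y' ≤ -x}`. -/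
noncomputable def noSolutionQ : PolytopeMap 2 3 where
  A := fun w => !![w 1, 0; 0, 1; 0, -1]
  b := fun w => !₂[0, w 0, -(w 0)]
  L := 2

/-- The operator `(∇ₓf, -∇_yf) = (-1, 0)` of `noSolutionInstance`. -/
noncomputable def noSolutionF : E 2 → E 2 := fun _ => !₂[-1, 0]

/-- `Q(x,y) = {(x',y') ∈ [0,1]² : x' = y, max(x,1/2) y' = 1/2}`, each equation written as two
inequalities. -/
noncomputable def irrationalQ : PolytopeMap 2 4 where
  A := fun w => !![1, 0; -1, 0; 0, max (w 0) (1 / 2); 0, -max (w 0) (1 / 2)]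
  b := fun w => !₂[w 1, -(w 1), 1 / 2, -(1 / 2)]
  L := 2

end CoupledMinMax

/-! The negative claims are small computations. In the first instance the second constraint forces
`x = y` and the first then gives `x ^ 2 ≤ 0`, so only the origin is feasible. There the minimizer is
unconstrained against `y = 0` and gains by moving right. In the irrational instance a solution has
equal coordinates whose square is `1 / 2`.

The existence claim for Kakutani rests on Brouwer's theorem. For `ε > 0` the strictly relaxed
constraints are convex in `z` and stable under small changes of `w`, so a partition of unity yields
a `C¹` selection with values in the cube. Its fixed point lies in `Q_ε`, and compactness lets `ε`
tend to `0` (`exists_mem_Q_of_pos`, `exists_isKakutaniSolution`).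

Brouwer is derived from `not_exists_contDiff_retraction`, by the volume argument of Milnor and
Rogers. For small `t` the map `x + t (r x - x)` carries the ball bijectively onto itself, so the
integral of its Jacobian is the volume of the ball. That integral is a polynomial in `t`, hence has
the same value at `t = 1`. But `r` has constant norm, so its Jacobian vanishes identically. The
polynomial step is done by Lagrange interpolation, uniformly in the matrix. -/

/-! ### Interpolation of the determinant. -/

section DetPolynomial

open Polynomial

/-- The values at small times determine the determinant of `1 + M`, linearly and uniformly in `M`. -/
theorem Matrix.exists_det_one_add_eq_sum {n : Type*} [Fintype n] [DecidableEq n] {η : ℝ}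
    (hη : 0 < η) : ∃ (s : Finset ℝ) (c : ℝ → ℝ), (∀ t ∈ s, 0 < t ∧ t < η) ∧ ∑ t ∈ s, c t = 1 ∧
      ∀ M : Matrix n n ℝ, (1 + M).det = ∑ t ∈ s, c t * (1 + t • M).det := by
  obtain ⟨s, hs, hcard⟩ := (Set.Ioo_infinite hη).exists_subset_card_eq (Fintype.card n + 1)
  have hinj : Set.InjOn (id : ℝ → ℝ) s := Function.injective_id.injOn
  have hne : s.Nonempty := Finset.card_pos.1 (by omega)
  -- Interpolation at `card n + 1` nodes is exact for `det (1 + X M)`, whose degree is at most `card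
  -- n`. The weights extrapolate to `1`, and their sum is `1` because the Lagrange basis sums to the
  -- constant polynomial `1`.
  refine ⟨s, fun t => (Lagrange.basis s id t).eval 1, fun t ht => hs ht, ?_, fun M => ?_⟩
  · rw [← eval_finsetSum, Lagrange.sum_basis hinj hne, eval_one]
  · set p : ℝ[X] := det ((X : ℝ[X]) • M.map C + (1 : Matrix n n ℝ).map C) with hp
    have hdeg : p.degree < s.card := by
      refine lt_of_le_of_lt degree_le_natDegree ?_
      rw [hcard]
      exact_mod_cast Nat.lt_succ_of_le (natDegree_det_X_add_C_le M 1)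
    have heval (t : ℝ) : p.eval t = (1 + t • M).det := by
      rw [hp, ← coe_evalRingHom, RingHom.map_det]
      congr 1
      ext i j
      simp [Matrix.one_apply, apply_ite (eval t), add_comm]
      ring
    have h := congrArg (eval 1) (Lagrange.eq_interpolate hinj hdeg)
    rw [heval, one_smul, Lagrange.interpolate_apply, eval_finsetSum] at h
    rw [h]
    refine Finset.sum_congr rfl fun t _ => ?_
    rw [eval_mul, eval_C, id, heval, mul_comm]

end DetPolynomial

/-! ### Brouwer's fixed point theorem by the volume argument. -/

section Brouwer

open MeasureTheory Metric Set

variable {V : Type*} [NormedAddCommGroup V]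

/-- Nodes and weights depend only on the dimension, so a single choice serves the derivatives at all
points and can be pulled out of an integral. -/
theorem ContinuousLinearMap.exists_det_one_add_eq_sum [NormedSpace ℝ V] [FiniteDimensional ℝ V]
    {η : ℝ} (hη : 0 < η) : ∃ (s : Finset ℝ) (c : ℝ → ℝ), (∀ t ∈ s, 0 < t ∧ t < η) ∧
      ∑ t ∈ s, c t = 1 ∧
      ∀ T : V →L[ℝ] V, (1 + T).det = ∑ t ∈ s, c t * (1 + t • T).det := by
  obtain ⟨s, c, hs, hc, h⟩ :=
    Matrix.exists_det_one_add_eq_sum (n := Fin (Module.finrank ℝ V)) hη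
  refine ⟨s, c, hs, hc, fun T => ?_⟩
  have key (t : ℝ) : (1 + t • T).det =
      (1 + t • LinearMap.toMatrix (Module.finBasis ℝ V) (Module.finBasis ℝ V) (T : V →ₗ[ℝ] V)).det := by
    rw [ContinuousLinearMap.det, ← LinearMap.det_toMatrix (Module.finBasis ℝ V)]
    congr 1
    simp [LinearMap.toMatrix_one, ContinuousLinearMap.toLinearMap_add]
  have h1 := key 1
  rw [one_smul, one_smul] at h1
  rw [h1, h]
  simp only [key]

/-- A map that is Lipschitz on a ball and vanishes off its interior is Lipschitz. -/
theorem LipschitzOnWith.of_eq_zero_off_ball [NormedSpace ℝ V] {K : ℝ≥0} {R : ℝ} {h : V → V}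
    (hK : LipschitzOnWith K h (closedBall 0 R)) (h0 : ∀ x, R ≤ ‖x‖ → h x = 0) :
    LipschitzWith K h := by
  have aux (x y : V) (hx : ‖x‖ ≤ R) (hy : R ≤ ‖y‖) : dist (h x) (h y) ≤ K * dist x y := by
    -- The segment from `x` to `y` meets the sphere, where `h` vanishes as it does at `y`; the
    -- crossing point is no farther from `x` than `y` is.
    obtain ⟨t, ht, hw⟩ : R ∈ (fun t : ℝ => ‖AffineMap.lineMap x y t‖) '' Icc (0 : ℝ) 1 := by
      refine intermediate_value_Icc zero_le_one ?_ ?_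
      · exact (AffineMap.lineMap_continuous.norm).continuousOn
      · simpa using ⟨hx, hy⟩
    simp only at hw
    have h1 := hK.dist_le_mul x (by simpa using hx) (AffineMap.lineMap x y t)
      (by simp [hw])
    rw [h0 _ hw.ge, dist_left_lineMap] at h1
    rw [h0 _ hy]
    refine h1.trans ?_
    gcongr
    rw [Real.norm_of_nonneg ht.1]
    exact mul_le_of_le_one_left dist_nonneg ht.2
  refine LipschitzWith.of_dist_le_mul fun x y => ?_
  rcases le_total ‖x‖ R with hx | hx <;> rcases le_total ‖y‖ R with hy | hy
  · exact hK.dist_le_mul x (by simpa using hx) y (by simpa using hy)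
  · exact aux x y hx hy
  · rw [dist_comm (h x), dist_comm x]
    exact aux y x hy hx
  · rw [h0 x hx, h0 y hy, dist_self]
    positivity

/-- A small Lipschitz perturbation of the identity is a bijection. -/
theorem bijective_id_add_smul [NormedSpace ℝ V] [CompleteSpace V] {K : ℝ≥0} {h : V → V}
    (hh : LipschitzWith K h) {t : ℝ} (ht : 0 < t) (htK : t * K < 1) :
    Function.Bijective fun x => x + t • h x := by
  -- Solutions of `x + t • h x = y` are the fixed points of this contraction.
  have hc (y : V) : ContractingWith (t.toNNReal * K) fun x => y - t • h x := by
    refine ⟨?_, LipschitzWith.of_dist_le_mul fun a b => ?_⟩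
    · rw [← NNReal.coe_lt_coe]
      simpa [Real.coe_toNNReal t ht.le] using htK
    · rw [dist_sub_left, dist_smul₀, NNReal.coe_mul, Real.coe_toNNReal t ht.le,
        Real.norm_of_nonneg ht.le, mul_assoc]
      exact mul_le_mul_of_nonneg_left (hh.dist_le_mul a b) ht.le
  refine ⟨fun a b hab => ?_, fun y => ⟨(hc y).fixedPoint _, ?_⟩⟩
  · refine (hc (a + t • h a)).fixedPoint_unique' ?_ ?_
    · simp [Function.IsFixedPt]
    · simp only at hab
      simp [Function.IsFixedPt, hab]
  · have := (hc y).fixedPoint_isFixedPt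
    simp only [Function.IsFixedPt] at this
    exact eq_sub_iff_add_eq.1 this.symm

/-- A bijection that is the identity off `s` maps `s` onto `s`. -/
theorem image_eq_self_of_eq_off {α : Type*} {s : Set α} {φ : α → α} (hφ : Function.Bijective φ)
    (h : ∀ x ∉ s, φ x = x) : φ '' s = s := by
  apply Subset.antisymm
  · rintro _ ⟨x, hx, rfl⟩
    by_contra hn
    exact hn (by rwa [hφ.1 (h _ hn)])
  · intro y hy
    obtain ⟨x, rfl⟩ := hφ.2 y
    by_cases hx : x ∈ s
    · exact ⟨x, hx, rfl⟩
    · rw [h x hx] at hy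
      exact absurd hy hx

/-- No retraction onto the sphere: a `C¹` map that fixes the sphere pointwise cannot have
constant norm. -/
theorem not_exists_contDiff_retraction [InnerProductSpace ℝ V] [FiniteDimensional ℝ V] {R : ℝ}
    (hR : 0 < R) (r : V → V) (hr : ContDiff ℝ 1 r) (hfix : ∀ x, ‖x‖ = R → r x = x)
    (hnorm : ∀ x, ‖r x‖ = R) : False := by
  borelize V
  set U : Set V := ball 0 R
  set D : V → V →L[ℝ] V := fun x => fderiv ℝ r x - 1 with hD
  have hDc : Continuous D := (hr.continuous_fderiv one_ne_zero).sub continuous_const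
  obtain ⟨K, hK0, hK⟩ : ∃ K : ℝ≥0, 0 < K ∧ ∀ x ∈ closedBall (0 : V) R, ‖D x‖ ≤ K := by
    obtain ⟨C, hC⟩ := (isCompact_closedBall (0 : V) R).exists_bound_of_continuousOn hDc.continuousOn
    -- The `+ 1` makes `K` positive, so that `τ` below can be a quotient by `K`.
    refine ⟨C.toNNReal + 1, by positivity, fun x hx => (hC x hx).trans ?_⟩
    rw [NNReal.coe_add]
    exact (Real.le_coe_toNNReal C).trans (by simp)
  have hrd (x : V) : HasFDerivAt (fun x => r x - x) (D x) x :=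
    ((hr.differentiable one_ne_zero).differentiableAt.hasFDerivAt).sub (hasFDerivAt_id x)
  classical
  -- Cutting off outside the ball makes `x + t • h x` the identity there; once bijective, it must
  -- map `U` onto itself.
  set h : V → V := fun x => if ‖x‖ ≤ R then r x - x else 0 with hh
  have h_off (x : V) (hx : R ≤ ‖x‖) : h x = 0 := by
    rcases hx.eq_or_lt with hx | hx
    · simp [hh, hfix x hx.symm]
    · simp [hh, hx.not_ge]
  have h_lip : LipschitzWith K h := by
    refine LipschitzOnWith.of_eq_zero_off_ball (R := R) ?_ h_off
    have : LipschitzOnWith K (fun x => r x - x) (closedBall 0 R) :=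
      (convex_closedBall (0 : V) R).lipschitzOnWith_of_nnnorm_hasFDerivWithin_le
        (fun x _ => (hrd x).hasFDerivWithinAt) fun x hx => hK x hx
    intro x hx y hy
    simpa [hh, mem_closedBall_zero_iff.1 hx, mem_closedBall_zero_iff.1 hy] using this hx hy
  have h_der (t : ℝ) (x : V) (hx : x ∈ U) :
      HasFDerivAt (fun x => x + t • h x) (1 + t • D x) x := by
    refine (hasFDerivAt_id x).add (((hrd x).congr_of_eventuallyEq ?_).const_smul t)
    filter_upwards [isOpen_ball.mem_nhds hx] with y hy
    simp [hh, (mem_ball_zero_iff.1 hy).le]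
  -- Positivity removes the absolute value from the change of variables formula, leaving a
  -- polynomial in `t`.
  obtain ⟨η, hη, hdet⟩ : ∃ η > 0, ∀ T : V →L[ℝ] V, ‖T‖ < η → 0 < (1 + T).det := by
    have hcont : Continuous fun T : V →L[ℝ] V => (1 + T).det :=
      ContinuousLinearMap.continuous_det.comp (continuous_const.add continuous_id)
    have h0 : (0 : ℝ) < (1 + (0 : V →L[ℝ] V)).det := by
      simp [ContinuousLinearMap.det]
    obtain ⟨η, hη, hsub⟩ := Metric.isOpen_iff.1 (isOpen_lt continuous_const hcont) 0 h0
    exact ⟨η, hη, fun T hT => hsub (by simpa using hT)⟩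
  -- For `t < τ`, the bound `t * K < 1` gives bijectivity and `t * K < η` gives a positive Jacobian.
  set τ : ℝ := min 1 η / K with hτ
  have hK0' : (0 : ℝ) < K := hK0
  have hτ0 : 0 < τ := div_pos (lt_min one_pos hη) hK0'
  have hint (t : ℝ) : IntegrableOn (fun x => (1 + t • D x).det) U := by
    have hcont : Continuous fun x => (1 + t • D x).det :=
      ContinuousLinearMap.continuous_det.comp (continuous_const.add (hDc.const_smul t))
    exact (hcont.continuousOn.integrableOn_compact (isCompact_closedBall (0 : V) R)).mono_set
      ball_subset_closedBall
  have hvol (t : ℝ) (ht : 0 < t) (htτ : t < τ) :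
      ∫ x in U, (1 + t • D x).det = (volume U).toReal := by
    have htK : t * K < min 1 η := (lt_div_iff₀ hK0').1 htτ
    have hbij := bijective_id_add_smul h_lip ht (htK.trans_le (min_le_left _ _))
    have himg : (fun x => x + t • h x) '' U = U :=
      image_eq_self_of_eq_off hbij fun x hx => by
        simp [h_off x (by simpa [U] using hx)]
    have hpos (x : V) (hx : x ∈ U) : 0 < (1 + t • D x).det := by
      refine hdet _ ?_
      rw [norm_smul, Real.norm_of_nonneg ht.le]
      refine (mul_le_mul_of_nonneg_left (hK x (ball_subset_closedBall hx)) ht.le).trans_lt ?_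
      exact htK.trans_le (min_le_right _ _)
    have := lintegral_abs_det_fderiv_eq_addHaar_image volume measurableSet_ball
      (fun x hx => (h_der t x hx).hasFDerivWithinAt) hbij.1.injOn
    rw [himg] at this
    rw [← this, integral_eq_lintegral_of_nonneg_ae]
    · congr 1
      refine setLIntegral_congr_fun measurableSet_ball fun x hx => ?_
      simp only [abs_of_pos (hpos x hx)]
    · filter_upwards [ae_restrict_mem measurableSet_ball] with x hx using (hpos x hx).le
    · exact (hint t).aestronglyMeasurable
  obtain ⟨s, c, hs, hc, hsum⟩ := ContinuousLinearMap.exists_det_one_add_eq_sum (V := V) hτ0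
  have hzero (x : V) : (1 + D x).det = 0 := by
    have h1 : 1 + D x = fderiv ℝ r x := by simp [hD]
    rw [h1]
    by_contra hne
    have hdr : HasFDerivAt r (fderiv ℝ r x) x :=
      (hr.differentiable one_ne_zero).differentiableAt.hasFDerivAt
    -- Differentiating the constant `‖r‖ ^ 2` puts the range of the derivative in the orthogonal
    -- complement of `r x ≠ 0`, so the derivative is not surjective.
    have horth (v : V) : inner ℝ (r x) (fderiv ℝ r x v) = 0 := by
      have h2 := hdr.norm_sq
      have h3 : (fun y => ‖r y‖ ^ 2) = fun _ => R ^ 2 := by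
        funext y
        rw [hnorm]
      rw [h3] at h2
      have h4 := congrArg (fun T : V →L[ℝ] ℝ => T v) (h2.unique (hasFDerivAt_const _ _))
      simpa using h4
    obtain ⟨v, hv⟩ := ((ContinuousLinearMap.toContinuousLinearEquivOfDetNeZero _ hne).surjective)
      (r x)
    have h5 := horth v
    rw [ContinuousLinearMap.toContinuousLinearEquivOfDetNeZero_apply] at hv
    rw [hv, real_inner_self_eq_norm_sq, hnorm] at h5
    exact (pow_pos hR 2).ne' h5
  have hfin : (0 : ℝ) = (volume U).toReal := by
    calc (0 : ℝ) = ∫ x in U, (1 + D x).det := by simp [hzero]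
      _ = ∫ x in U, ∑ t ∈ s, c t * (1 + t • D x).det :=
        congrArg _ (funext fun x => hsum _)
      _ = ∑ t ∈ s, c t * (volume U).toReal := by
        rw [integral_finsetSum _ fun t _ => (hint t).const_mul _]
        refine Finset.sum_congr rfl fun t ht => ?_
        rw [integral_const_mul, hvol t (hs t ht).1 (hs t ht).2]
      _ = (volume U).toReal := by rw [← Finset.sum_mul, hc, one_mul]
  refine (ENNReal.toReal_pos ?_ ?_).ne hfin
  · exact (measure_ball_pos _ _ hR).ne'
  · exact measure_ball_lt_top.ne

/-- Brouwer's fixed point theorem for bounded `C¹` maps of the whole space. -/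
theorem exists_fixedPoint_of_contDiff_of_bounded [InnerProductSpace ℝ V] [FiniteDimensional ℝ V]
    {R : ℝ} (g : V → V) (hg : ContDiff ℝ 1 g) (hb : ∀ x, ‖g x‖ ≤ R) : ∃ x, g x = x := by
  by_contra! hne
  have hR : 0 ≤ R := (norm_nonneg _).trans (hb 0)
  -- A zero of `x - χ x • g x` has norm at most `R`, where `χ = 1`, so it would be a fixed point of
  -- `g`. On the sphere of radius `R + 2`, `χ = 0` and the map is the identity; rescaling it to norm
  -- `R + 2` gives a retraction.
  let χ : ContDiffBump (0 : V) := ⟨R + 1, R + 2, by linarith, by linarith⟩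
  set F : V → V := fun x => x - χ x • g x with hF
  have hF0 (x : V) : F x ≠ 0 := by
    intro h0
    have hx : x = χ x • g x := sub_eq_zero.1 h0
    have hle : ‖x‖ ≤ R := by
      rw [hx, norm_smul, Real.norm_of_nonneg χ.nonneg]
      exact (mul_le_of_le_one_left (norm_nonneg _) χ.le_one).trans (hb x)
    have h1 : χ x = 1 := χ.one_of_mem_closedBall (by
      rw [mem_closedBall_zero_iff]
      change ‖x‖ ≤ R + 1
      linarith)
    rw [h1, one_smul] at hx
    exact hne x hx.symm
  have hFc : ContDiff ℝ 1 F := contDiff_id.sub (χ.contDiff.smul hg)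
  refine not_exists_contDiff_retraction (R := R + 2) (by linarith)
    (fun x => ((R + 2) / ‖F x‖) • F x) ?_ (fun x hx => ?_) fun x => ?_
  · exact (contDiff_const.div (hFc.norm ℝ hF0) fun x => norm_ne_zero_iff.2 (hF0 x)).smul hFc
  · have h0 : χ x = 0 := χ.zero_of_le_dist (by
      rw [dist_zero_right]
      exact hx.ge)
    have : F x = x := by simp [hF, h0]
    simp only [this, hx]
    rw [div_self (by linarith), one_smul]
  · rw [norm_smul, norm_div, norm_norm, div_mul_cancel₀ _ (norm_ne_zero_iff.2 (hF0 x)),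
      Real.norm_of_nonneg (by linarith)]

end Brouwer

/-! ### Existence of Kakutani solutions. -/

namespace CoupledMinMax

open Set Filter Topology

theorem isClosed_cube (d : ℕ) : IsClosed (cube d) := by
  have : cube d = ⋂ i, (fun z : E d => z i) ⁻¹' Icc 0 1 := by
    ext z
    simp [cube]
  rw [this]
  exact isClosed_iInter fun i => isClosed_Icc.preimage (by fun_prop)

theorem norm_le_of_mem_cube {d : ℕ} {z : E d} (hz : z ∈ cube d) : ‖z‖ ≤ √d := by
  rw [EuclideanSpace.norm_eq]
  refine Real.sqrt_le_sqrt ?_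
  calc ∑ i, ‖z i‖ ^ 2 ≤ ∑ _i : Fin d, (1 : ℝ) := Finset.sum_le_sum fun i _ => by
        rw [Real.norm_eq_abs, sq_abs]
        exact pow_le_one₀ (hz i).1 (hz i).2
    _ = d := by simp

theorem isCompact_cube (d : ℕ) : IsCompact (cube d) :=
  (isCompact_closedBall (0 : E d) (√d)).of_isClosed_subset (isClosed_cube d) fun z hz => by
    simpa using norm_le_of_mem_cube hz

theorem zero_mem_cube (d : ℕ) : (0 : E d) ∈ cube d := fun i => by simp

theorem convex_cube (d : ℕ) : Convex ℝ (cube d) := by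
  intro x hx y hy a b ha hb hab i
  have := convex_Icc (0 : ℝ) 1 (hx i) (hy i) ha hb hab
  simpa using this

namespace PolytopeMap

variable {d n : ℕ} {R : PolytopeMap d n}

theorem IsValid.continuousOn_mulVec (hR : R.IsValid) {z : E d} (hz : z ∈ cube d) (i : Fin n) :
    ContinuousOn (fun w => (R.A w *ᵥ coords z) i) (cube d) :=
  (show Continuous fun v : E n => v i by fun_prop).comp_continuousOn
    (hR.lipschitz_A z hz).continuousOn

theorem IsValid.continuousOn_b (hR : R.IsValid) (i : Fin n) :
    ContinuousOn (fun w => R.b w i) (cube d) :=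
  (show Continuous fun v : E n => v i by fun_prop).comp_continuousOn hR.lipschitz_b.continuousOn

/-- The Lipschitz assumption fixes `z`, whereas closedness of the fixed point set needs continuity
of `A(z) z` in `z`. The unit vectors lie in the cube, so the entries can be recovered. -/
theorem IsValid.continuousOn_entry (hR : R.IsValid) (i : Fin n) (j : Fin d) :
    ContinuousOn (fun w => R.A w i j) (cube d) := by
  have hmem : (EuclideanSpace.single j (1 : ℝ)) ∈ cube d := fun k => by
    by_cases h : k = j <;> simp [h]
  refine (hR.continuousOn_mulVec hmem i).congr fun w _ => ?_
  have : coords (EuclideanSpace.single j (1 : ℝ)) = Pi.single j 1 := by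
    ext k
    simp [coords, Pi.single_apply]
  simp [this]

theorem isClosed_setOf_mem_Q (hR : R.IsValid) (ν : ℝ) : IsClosed {z | z ∈ R.Q ν z} := by
  have hset : {z | z ∈ R.Q ν z} =
      cube d ∩ ⋂ i, cube d ∩ (fun z => (R.A z *ᵥ coords z) i - R.b z i) ⁻¹' Iic ν := by
    ext z
    simp only [Q, mem_ofPred_eq, mem_inter_iff, mem_iInter, mem_preimage, mem_Iic,
      sub_le_iff_le_add']
    exact ⟨fun h => ⟨h.1, fun i => ⟨h.1, h.2 i⟩⟩, fun h => ⟨h.1, fun i => (h.2 i).2⟩⟩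
  rw [hset]
  refine (isClosed_cube d).inter (isClosed_iInter fun i => ?_)
  refine ContinuousOn.preimage_isClosed_of_isClosed ?_ (isClosed_cube d) isClosed_Iic
  refine ContinuousOn.sub ?_ (hR.continuousOn_b i)
  simp only [Matrix.mulVec, dotProduct]
  refine continuousOn_finsetSum _ fun j _ => (hR.continuousOn_entry i j).mul ?_
  exact (show Continuous fun z : E d => z j by fun_prop).continuousOn

theorem convex_setOf_mulVec_lt (w : E d) (ε : ℝ) :
    Convex ℝ {z | ∀ i, (R.A w *ᵥ coords z) i < R.b w i + ε} := by
  intro x hx y hy a b ha hb hab i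
  have hlin : (R.A w *ᵥ coords (a • x + b • y)) i =
      a • (R.A w *ᵥ coords x) i + b • (R.A w *ᵥ coords y) i := by
    have : coords (a • x + b • y) = a • coords x + b • coords y := rfl
    rw [this, Matrix.mulVec_add, Matrix.mulVec_smul, Matrix.mulVec_smul]
    rfl
  rw [hlin]
  exact convex_Iio (R.b w i + ε) (hx i) (hy i) ha hb hab

/-- Relaxed by a positive amount, the correspondence has a fixed point, since it has a smooth
selection. -/
theorem exists_mem_Q_of_pos (hR : R.IsValid) {ε : ℝ} (hε : 0 < ε) : ∃ z, z ∈ R.Q ε z := by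
  -- Strict inequalities keep a point of `Q_0(w)` admissible for all nearby parameters. Off the cube
  -- only membership in the cube is required, so the selection is defined and bounded on the whole
  -- space.
  let T : E d → Set (E d) := fun w =>
    cube d ∩ {z | w ∈ cube d → ∀ i, (R.A w *ᵥ coords z) i < R.b w i + ε}
  have hT (w : E d) : Convex ℝ (T w) := by
    refine (convex_cube d).inter ?_
    by_cases hw : w ∈ cube d
    · simpa [hw] using convex_setOf_mulVec_lt w ε
    · simpa [hw] using! convex_univ
  have hloc (w : E d) : ∃ c, ∀ᶠ y in 𝓝 w, c ∈ T y := by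
    by_cases hw : w ∈ cube d
    · obtain ⟨c, hc, hcw⟩ := hR.nonempty w hw
      refine ⟨c, ?_⟩
      have : ∀ᶠ y in 𝓝[cube d] w, ∀ i, (R.A y *ᵥ coords c) i < R.b y i + ε := by
        refine eventually_all.2 fun i => ?_
        refine (hR.continuousOn_mulVec hc i w hw).eventually_lt
          ((hR.continuousOn_b i w hw).add continuousWithinAt_const) ?_
        exact (hcw i).trans_lt (by simpa using hε)
      filter_upwards [eventually_nhdsWithin_iff.1 this] with y hy using ⟨hc, hy⟩
    · refine ⟨0, ?_⟩
      filter_upwards [(isClosed_cube d).isOpen_compl.mem_nhds hw] with y hy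
      exact ⟨zero_mem_cube d, fun h => absurd h hy⟩
  obtain ⟨g, hg⟩ := exists_contMDiffMap_forall_mem_convex_of_local_const
    (n := 1) (modelWithCornersSelf ℝ (E d)) hT hloc
  obtain ⟨z, hz⟩ := exists_fixedPoint_of_contDiff_of_bounded (fun x => g x)
    (contMDiff_iff_contDiff.1 g.contMDiff) fun x => norm_le_of_mem_cube (hg x).1
  -- The value `g z` lies in the cube; since it equals `z`, the constraints conditional on `z ∈ cube
  -- d` become active.
  have hzT := hg z
  rw [show g z = z from hz] at hzT
  exact ⟨z, hzT.1, fun i => (hzT.2 hzT.1 i).le⟩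

theorem Q_mono {ν ν' : ℝ} (h : ν ≤ ν') (w : E d) : R.Q ν w ⊆ R.Q ν' w :=
  fun _ hz => ⟨hz.1, fun i => (hz.2 i).trans (by linarith)⟩

/-- The Kakutani problem has a solution. -/
theorem exists_isKakutaniSolution (hR : R.IsValid) {ν : ℝ} (hν : 0 ≤ ν) :
    ∃ z, R.IsKakutaniSolution ν z := by
  -- Nested nonempty compact sets: a common point satisfies the constraints with slack `0`, hence
  -- with every `ν ≥ 0`.
  let S : ℕ → Set (E d) := fun k => {z | z ∈ R.Q (1 / ((k : ℝ) + 1)) z}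
  obtain ⟨z, hz⟩ : (⋂ k, S k).Nonempty := by
    refine IsCompact.nonempty_iInter_of_sequence_nonempty_isCompact_isClosed S (fun k z hz => ?_)
      (fun k => exists_mem_Q_of_pos hR Nat.one_div_pos_of_nat) ?_
      fun k => isClosed_setOf_mem_Q hR _
    · refine Q_mono ?_ z hz
      exact Nat.one_div_le_one_div k.le_succ
    · exact (isCompact_cube d).of_isClosed_subset (isClosed_setOf_mem_Q hR _) fun z hz => hz.1
  rw [mem_iInter] at hz
  refine ⟨z, (hz 0).1, Q_mono hν z ⟨(hz 0).1, fun i => ?_⟩⟩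
  refine ge_of_tendsto' (x := atTop) (f := fun k : ℕ => R.b z i + 1 / ((k : ℝ) + 1)) ?_
    fun k => (hz k).2 i
  exact tendsto_const_nhds.add tendsto_one_div_add_atTop_nhds_zero_nat

end PolytopeMap

end CoupledMinMax

namespace CoupledMinMax

/-! ### The explicit instances -/

theorem lipschitzOnWith_of_sum_sq_le {k n : ℕ} {K : ℝ≥0} {f : E k → E n} {s : Set (E k)}
    (h : ∀ x ∈ s, ∀ y ∈ s, ∑ i, (f x i - f y i) ^ 2 ≤ (K : ℝ) ^ 2 * ∑ j, (x j - y j) ^ 2) :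
    LipschitzOnWith K f s := by
  refine LipschitzOnWith.of_dist_le_mul fun x hx y hy => ?_
  rw [dist_eq_norm, dist_eq_norm]
  refine abs_le_of_sq_le_sq' ?_ (by positivity) |>.2
  rw [mul_pow, EuclideanSpace.norm_sq_eq, EuclideanSpace.norm_sq_eq]
  simpa [Real.norm_eq_abs, sq_abs] using h x hx y hy

theorem maxEval_two {d : ℕ} (h : Fin 2 → BilinearFn d) (x y : E d) :
    maxEval h x y = max ((h 0).eval x y) ((h 1).eval x y) := by
  refine le_antisymm (Finset.sup'_le _ _ fun j _ => ?_) (max_le ?_ ?_)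
  · fin_cases j
    · exact le_max_left _ _
    · exact le_max_right _ _
  · exact Finset.le_sup' (fun j => (h j).eval x y) (Finset.mem_univ 0)
  · exact Finset.le_sup' (fun j => (h j).eval x y) (Finset.mem_univ 1)

/-- A point of `K` is at distance `0` from itself, so the choice in `proj` is forced without
closedness or convexity. -/
theorem proj_eq_self {d : ℕ} {K : Set (E d)} {u : E d} (hu : u ∈ K) : proj K u = u := by
  have h : ∃ p, IsNearest K u p := ⟨u, hu, fun q _ => by simp⟩
  rw [proj, dif_pos h]
  have := h.choose_spec.2 u hu
  rw [sub_self, norm_zero, norm_le_zero_iff, sub_eq_zero] at this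
  exact this.symm

theorem noSolutionInstance_g₁ (x y : E 1) : noSolutionInstance.g₁ x y = x 0 * y 0 := by
  simp [MinMaxInstance.g₁, noSolutionInstance, maxEval_two, BilinearFn.eval, coords,
    Matrix.mulVec, dotProduct]

theorem noSolutionInstance_g₂ (x y : E 1) :
    noSolutionInstance.g₂ x y = max (x 0 - y 0) (y 0 - x 0) := by
  simp [MinMaxInstance.g₂, noSolutionInstance, maxEval_two, BilinearFn.eval, coords,
    Matrix.mulVec, dotProduct, sub_eq_add_neg, add_comm]

theorem noSolutionInstance_isValid : noSolutionInstance.IsValid where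
  bounded p hp := by
    have := hp.1 0
    simp only [noSolutionInstance, NNReal.coe_one, abs_le]
    constructor <;> linarith
  hasGradient p _ := by
    have h := ((InnerProductSpace.toDual ℝ (P 1)
      (noSolutionInstance.grad p)).hasFDerivAt (x := p)).const_add 1
    refine HasFDerivAt.hasFDerivWithinAt (h.congr_of_eventuallyEq (.of_forall fun q => ?_))
    simp [noSolutionInstance, pair, sub_eq_add_neg, PiLp.inner_apply]
  lipschitz := by
    refine LipschitzOnWith.of_dist_le_mul fun p _ q _ => ?_
    have h1 : |(p - q).fst 0| ≤ ‖p - q‖ :=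
      (PiLp.norm_apply_le (p - q).fst 0).trans (WithLp.norm_fst_le _ _)
    rw [Real.dist_eq, dist_eq_norm]
    simp only [noSolutionInstance, NNReal.coe_one, one_mul]
    rw [← abs_neg]
    convert h1 using 2
    simp
  smooth := LipschitzOnWith.of_dist_le_mul fun p _ q _ => by
    simp only [noSolutionInstance, dist_self]
    positivity
  f_circuit := by
    refine ⟨4, (((Circuit.nil.snoc (.input (.inl 0))).snoc (.const 1)).snoc (.scale (-1) 0)).snoc
      (.add 1 2), fun _ => 3, fun j => ?_, fun x _ j => ?_⟩
    -- This circuit, like all the later ones, has no multiplication gate, so the depth is `0`.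
    · exact le_trans (by revert j; decide) (Nat.zero_le _)
    · simp [Circuit.eval, Gate.eval, Fin.snoc, pairCoords, coords, noSolutionInstance,
        sub_eq_add_neg]
  grad_circuit := by
    refine ⟨2, (Circuit.nil.snoc (.const (-1))).snoc (.const 0), Sum.elim (fun _ => 0) (fun _ => 1),
      fun j => ?_, fun x _ j => ?_⟩
    · exact le_trans (by revert j; decide) (Nat.zero_le _)
    · rcases j with j | j <;> fin_cases j <;>
        simp [Circuit.eval, Gate.eval, Fin.snoc, pairCoords, coords, noSolutionInstance, pair]
  g₁_range x hx y hy := by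
    rw [noSolutionInstance_g₁, abs_of_nonneg (mul_nonneg (hx 0).1 (hy 0).1)]
    exact mul_le_one₀ (hx 0).2 (hy 0).1 (hy 0).2
  g₂_range x hx y hy := by
    have hx := hx 0
    have hy := hy 0
    rw [noSolutionInstance_g₂, abs_le]
    exact ⟨le_max_iff.2 (by by_contra! h; linarith [h.1, h.2]), max_le (by linarith) (by linarith)⟩
  K₁_nonempty y _ := ⟨0, zero_mem_cube 1, by simp [noSolutionInstance_g₁]⟩
  K₂_nonempty x hx := ⟨x, hx, by simp [noSolutionInstance_g₂]⟩

theorem noSolutionInstance_localRegime {ε : ℝ} (h0 : 0 < ε) (h1 : ε < 1) :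
    noSolutionInstance.LocalRegime ε (5 / 4 * ε) := by
  -- The bound amounts to `25 / 16 * ε ^ 2 < 2 * ε`, which follows from `0 < ε < 1`.
  refine ⟨h0, by linarith, Real.lt_sqrt_of_sq_lt ?_⟩
  simp only [noSolutionInstance, NNReal.coe_one, div_one]
  nlinarith

/-- At `ν = 0` the constraints of the two players leave only the origin. -/
theorem noSolutionInstance_feasible {x y : E 1} (hx : x ∈ cube 1)
    (h₁ : noSolutionInstance.g₁ x y ≤ 0) (h₂ : noSolutionInstance.g₂ x y ≤ 0) :
    x = 0 ∧ y = 0 := by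
  rw [noSolutionInstance_g₁] at h₁
  rw [noSolutionInstance_g₂, max_le_iff] at h₂
  have hxy : y 0 = x 0 := by linarith [h₂.1, h₂.2]
  rw [hxy] at h₁
  have hx0 : x 0 = 0 := by nlinarith [(hx 0).1]
  constructor
  · ext i
    fin_cases i
    exact hx0
  · ext i
    fin_cases i
    exact hxy.trans hx0

theorem noSolutionInstance_not_exists_isLocalMinMax {ε δ : ℝ} (h0 : 0 < ε) (h1 : ε < 1)
    (hεδ : ε < δ) : ¬ ∃ x y : E 1, noSolutionInstance.IsLocalMinMax ε δ 0 x y := by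
  rintro ⟨x, y, hx, -, h₁, h₂, hmin, -⟩
  obtain ⟨rfl, rfl⟩ := noSolutionInstance_feasible hx h₁ h₂
  have hδ : 0 ≤ min δ 1 := le_min (h0.trans hεδ).le zero_le_one
  -- The farthest move to the right that the radius and the cube allow; it lowers `f` by `min δ 1 >
  -- ε`.
  have h := hmin (!₂[min δ 1]) (fun i => by
    fin_cases i
    exact ⟨hδ, min_le_right _ _⟩) ?_ (by simp [noSolutionInstance_g₁])
  · simp [noSolutionInstance, pair] at h
    have hlt : ε < min δ 1 := lt_min hεδ h1
    linarith
  · rw [sub_zero, EuclideanSpace.norm_eq]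
    simp [Real.sqrt_sq_eq_abs, abs_of_nonneg hδ]

theorem noSolutionInstance_not_exists_isGDAFixedPoint {α : ℝ} (hα : α < 1) :
    ¬ ∃ x y : E 1, noSolutionInstance.IsGDAFixedPoint α 0 x y := by
  rintro ⟨x, y, hx, -, h₁, h₂, h⟩
  obtain ⟨rfl, rfl⟩ := noSolutionInstance_feasible hx h₁ h₂
  -- The descent step from the origin lands on the feasible point `1`, so the first component alone
  -- moves by `1 > α`; the second projection is never evaluated.
  have hstep : (0 : E 1) - (noSolutionInstance.grad (pair 0 0)).fst = !₂[1] := by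
    ext i
    fin_cases i
    simp [noSolutionInstance, pair]
  have hmem : (!₂[1] : E 1) ∈ noSolutionInstance.K₁ 0 0 := by
    refine ⟨fun i => ?_, by simp [noSolutionInstance_g₁]⟩
    fin_cases i
    simp
  have hfst := WithLp.norm_fst_le (x := pair 0 0 - noSolutionInstance.gda 0 0 0)
  rw [MinMaxInstance.gda, hstep, proj_eq_self hmem] at hfst
  have : (1 : ℝ) ≤ ‖(pair (0 : E 1) 0 - pair (!₂[1]) (proj (noSolutionInstance.K₂ 0 0)
      (0 + (noSolutionInstance.grad (pair 0 0)).snd))).fst‖ := by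
    simp [pair, EuclideanSpace.norm_eq]
  rw [MinMaxInstance.gda, hstep, proj_eq_self hmem] at h
  linarith

theorem noSolutionQ_mem_Q {w z : E 2} : z ∈ noSolutionQ.Q 0 w ↔
    z ∈ cube 2 ∧ w 1 * z 0 ≤ 0 ∧ z 1 = w 0 := by
  rw [PolytopeMap.Q, Set.mem_ofPred_eq]
  refine and_congr_right fun _ => ?_
  simp [noSolutionQ, Fin.forall_fin_succ, Matrix.mulVec, dotProduct, coords, le_antisymm_iff]

theorem noSolutionQ_isValid : noSolutionQ.IsValid where
  lipschitz_A z hz := by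
    refine lipschitzOnWith_of_sum_sq_le fun x _ y _ => ?_
    have h0 := hz 0
    simp [noSolutionQ, Fin.sum_univ_succ, Matrix.mulVec, dotProduct, coords]
    have : z 0 ^ 2 ≤ 1 := pow_le_one₀ h0.1 h0.2
    rw [← sub_mul, mul_pow]
    nlinarith [sq_nonneg (x 0 - y 0), sq_nonneg (x 1 - y 1)]
  lipschitz_b := by
    refine lipschitzOnWith_of_sum_sq_le fun x _ y _ => ?_
    simp [noSolutionQ, Fin.sum_univ_succ]
    nlinarith [sq_nonneg (x 0 - y 0), sq_nonneg (x 1 - y 1)]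
  nonempty w hw := by
    refine ⟨!₂[0, w 0], noSolutionQ_mem_Q.2 ⟨fun i => ?_, by simp, by simp⟩⟩
    have := hw 0
    fin_cases i <;> simp [this]

theorem noSolutionQ_hasCircuits : noSolutionQ.HasCircuits := by
  constructor
  · refine ⟨4, (((Circuit.nil.snoc (.input 1)).snoc (.const 0)).snoc (.const 1)).snoc
      (.const (-1)), fun ij => ![![0, 1], ![1, 2], ![1, 3]] ij.1 ij.2, fun j => ?_, fun x _ j => ?_⟩
    · exact le_trans (by revert j; decide) (Nat.zero_le _)
    · obtain ⟨i, j⟩ := j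
      fin_cases i <;> fin_cases j
      exacts [rfl, Rat.cast_zero, Rat.cast_zero, Rat.cast_one, Rat.cast_zero,
        (by simp : ((-1 : ℚ) : ℝ) = -1)]
  · refine ⟨3, ((Circuit.nil.snoc (.input 0)).snoc (.const 0)).snoc (.scale (-1) 0), ![1, 0, 2],
      fun j => ?_, fun x _ j => ?_⟩
    · exact le_trans (by revert j; decide) (Nat.zero_le _)
    · fin_cases j
      exacts [Rat.cast_zero, rfl, (by simp : ((-1 : ℚ) : ℝ) * x 0 = -x 0)]

theorem noSolutionF_circuitComputable :
    CircuitComputable coords Set.univ fun z => coords (noSolutionF z) := by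
  refine ⟨2, (Circuit.nil.snoc (.const (-1))).snoc (.const 0), id, fun j => ?_, fun x _ j => ?_⟩
  · exact le_trans (by revert j; decide) (Nat.zero_le _)
  · fin_cases j <;> simp [Circuit.eval, Gate.eval, Fin.snoc, coords, noSolutionF]

theorem noSolutionQ_not_exists_isQuasiVISolution {ε : ℝ} (hε : ε < 1) :
    ¬ ∃ z : E 2, noSolutionQ.IsQuasiVISolution noSolutionF ε 0 z := by
  rintro ⟨z, hz, hzQ, h⟩
  obtain ⟨-, h1, h2⟩ := noSolutionQ_mem_Q.1 hzQ
  rw [h2] at h1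
  have h0 : z 0 = 0 := by nlinarith [(hz 0).1]
  -- At `z = 0` the feasible set is `[0,1] × {0}`, and the inner product with this test point is `-1
  -- < -ε`.
  have := h (!₂[1, 0]) (noSolutionQ_mem_Q.2 ⟨fun i => by fin_cases i <;> simp, by simp [h2, h0],
    by simp [h0]⟩)
  simp [noSolutionF, PiLp.inner_apply, Fin.sum_univ_two, h0] at this
  linarith

theorem irrationalQ_mem_Q {w z : E 2} : z ∈ irrationalQ.Q 0 w ↔
    z ∈ cube 2 ∧ z 0 = w 1 ∧ max (w 0) (1 / 2) * z 1 = 1 / 2 := by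
  rw [PolytopeMap.Q, Set.mem_ofPred_eq]
  refine and_congr_right fun _ => ?_
  simp [irrationalQ, Fin.forall_fin_succ, Matrix.mulVec, dotProduct, coords, le_antisymm_iff, and_assoc]

theorem irrationalQ_isValid : irrationalQ.IsValid where
  lipschitz_A z hz := by
    refine lipschitzOnWith_of_sum_sq_le fun x _ y _ => ?_
    have h1 := hz 1
    have hmax : (max (x 0) (1 / 2) - max (y 0) (1 / 2)) ^ 2 ≤ (x 0 - y 0) ^ 2 :=
      sq_le_sq.2 (abs_max_sub_max_le_abs _ _ _)
    have hz1 : z 1 ^ 2 ≤ 1 := pow_le_one₀ h1.1 h1.2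
    have hprod : (max (x 0) (1 / 2) * z 1 - max (y 0) (1 / 2) * z 1) ^ 2 ≤ (x 0 - y 0) ^ 2 := by
      rw [← sub_mul, mul_pow]
      exact (mul_le_of_le_one_right (sq_nonneg _) hz1).trans hmax
    simp [irrationalQ, Fin.sum_univ_succ, Matrix.mulVec, dotProduct, coords] at hprod ⊢
    -- The two rows of opposite sign contribute `hprod` twice, so the factor needed is `2`, below `L
    -- ^ 2 = 4`.
    nlinarith [sq_nonneg (x 0 - y 0), sq_nonneg (x 1 - y 1)]
  lipschitz_b := by
    refine lipschitzOnWith_of_sum_sq_le fun x _ y _ => ?_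
    simp [irrationalQ, Fin.sum_univ_succ]
    nlinarith [sq_nonneg (x 0 - y 0), sq_nonneg (x 1 - y 1)]
  nonempty w hw := by
    have hmax : 1 / 2 ≤ max (w 0) (1 / 2) := le_max_right _ _
    have hpos : 0 < max (w 0) (1 / 2) := by linarith
    -- The floor `1 / 2` inside the maximum is what keeps the second coordinate at most `1`.
    refine ⟨!₂[w 1, 1 / 2 / max (w 0) (1 / 2)], irrationalQ_mem_Q.2 ⟨fun i => ?_, by simp, ?_⟩⟩
    · fin_cases i
      · exact hw 1
      · exact ⟨div_nonneg one_half_pos.le hpos.le, (div_le_one hpos).2 hmax⟩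
    · exact mul_div_cancel₀ _ hpos.ne'

theorem irrationalQ_hasCircuits : irrationalQ.HasCircuits := by
  constructor
  · refine ⟨7, ((((((Circuit.nil.snoc (.input 0)).snoc (.const (1 / 2))).snoc (.max 0 1)).snoc
      (.scale (-1) 2)).snoc (.const 1)).snoc (.const (-1))).snoc (.const 0),
      fun ij => ![![4, 6], ![5, 6], ![6, 2], ![6, 3]] ij.1 ij.2, fun j => ?_, fun x _ j => ?_⟩
    · exact le_trans (by revert j; decide) (Nat.zero_le _)
    · obtain ⟨i, j⟩ := j
      have hhalf : max (x 0) ((1 / 2 : ℚ) : ℝ) = max (x 0) (1 / 2) := by simp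
      fin_cases i <;> fin_cases j
      exacts [Rat.cast_one, Rat.cast_zero, (by simp : ((-1 : ℚ) : ℝ) = -1), Rat.cast_zero,
        Rat.cast_zero, hhalf, Rat.cast_zero,
        (by rw [hhalf]; simp : ((-1 : ℚ) : ℝ) * max (x 0) ((1 / 2 : ℚ) : ℝ) = -max (x 0) (1 / 2))]
  · refine ⟨4, (((Circuit.nil.snoc (.input 1)).snoc (.scale (-1) 0)).snoc (.const (1 / 2))).snoc
      (.const (-(1 / 2))), id, fun j => ?_, fun x _ j => ?_⟩
    · exact le_trans (by revert j; decide) (Nat.zero_le _)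
    · fin_cases j
      exacts [rfl, (by simp : ((-1 : ℚ) : ℝ) * x 1 = -x 1), (by simp : ((1 / 2 : ℚ) : ℝ) = 1 / 2),
        (by simp : ((-(1 / 2) : ℚ) : ℝ) = -(1 / 2))]

theorem irrationalQ_isKakutaniSolution_iff (z : E 2) :
    irrationalQ.IsKakutaniSolution 0 z ↔ z = !₂[1 / √2, 1 / √2] := by
  have hs : (0 : ℝ) < √2 := by positivity
  have hsq : (1 / √2 : ℝ) ^ 2 = 1 / 2 := by
    rw [div_pow, Real.sq_sqrt zero_le_two, one_pow]
  have hp : 0 < 1 / √2 := by positivity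
  rw [PolytopeMap.IsKakutaniSolution, irrationalQ_mem_Q]
  constructor
  · rintro ⟨hz, -, h0, h1⟩
    have hz0 := hz 0
    rw [← h0] at h1
    -- Below `1 / 2` the maximum would be `1 / 2`, forcing `z 0 = 1`. So the maximum is `z 0`, and
    -- the equation becomes `z 0 ^ 2 = 1 / 2`.
    have hle : 1 / 2 ≤ z 0 := by
      by_contra! hlt
      rw [max_eq_right hlt.le] at h1
      linarith
    rw [max_eq_left hle] at h1
    have hz0 : z 0 = 1 / √2 := by nlinarith
    ext i
    fin_cases i
    · exact hz0
    · exact h0.symm.trans hz0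
  · rintro rfl
    have hlt : 1 / √2 ≤ 1 := by nlinarith
    have hle : 1 / 2 ≤ 1 / √2 := by nlinarith
    have hc : (!₂[1 / √2, 1 / √2] : E 2) ∈ cube 2 := fun i => by
      fin_cases i <;> exact ⟨hp.le, hlt⟩
    refine ⟨hc, hc, rfl, ?_⟩
    change max (1 / √2) (1 / 2) * (1 / √2) = 1 / 2
    rw [max_eq_left hle, ← sq, hsq]

theorem irrational_one_div_sqrt_two : Irrational (1 / √2) := by
  rw [one_div]
  exact irrational_sqrt_two.inv

end CoupledMinMax

theorem mainTheorem7 :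
    -- the local min-max problem in the local regime, with `ν = 0`
    (CoupledMinMax.noSolutionInstance.IsValid ∧
      (∀ ε : ℝ, 0 < ε → ε < 1 →
        CoupledMinMax.noSolutionInstance.LocalRegime ε (5 / 4 * ε)) ∧
      (∀ ε δ : ℝ, 0 < ε → ε < 1 → ε < δ →
        CoupledMinMax.noSolutionInstance.LocalRegime ε δ →
        ¬ ∃ x y : CoupledMinMax.E 1,
          CoupledMinMax.noSolutionInstance.IsLocalMinMax ε δ 0 x y) ∧
      -- fixed points of gradient descent-ascent, with `ν = 0`
      (∀ α : ℝ, 0 ≤ α → α < 1 →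
        ¬ ∃ x y : CoupledMinMax.E 1,
          CoupledMinMax.noSolutionInstance.IsGDAFixedPoint α 0 x y)) ∧
    -- the associated quasi-variational inequality, with `ν = 0`
    (CoupledMinMax.noSolutionQ.IsValid ∧ CoupledMinMax.noSolutionQ.HasCircuits ∧
      LipschitzWith 1 CoupledMinMax.noSolutionF ∧
      CoupledMinMax.CircuitComputable CoupledMinMax.coords Set.univ
        (fun z => CoupledMinMax.coords (CoupledMinMax.noSolutionF z)) ∧
      (∀ ε : ℝ, 0 < ε → ε < 1 →
        ¬ ∃ z : CoupledMinMax.E 2,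
          CoupledMinMax.noSolutionQ.IsQuasiVISolution CoupledMinMax.noSolutionF ε 0 z)) ∧
    -- the Kakutani problem always has a solution, for every `ν ≥ 0`
    (∀ (d n : ℕ) (R : CoupledMinMax.PolytopeMap d n), R.IsValid →
      ∀ ν : ℝ, 0 ≤ ν → ∃ z : CoupledMinMax.E d, R.IsKakutaniSolution ν z) ∧
    -- but possibly only irrational ones
    (CoupledMinMax.irrationalQ.IsValid ∧ CoupledMinMax.irrationalQ.HasCircuits ∧
      (∀ z : CoupledMinMax.E 2, CoupledMinMax.irrationalQ.IsKakutaniSolution 0 z ↔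
        z = !₂[1 / √2, 1 / √2]) ∧
      Irrational (1 / √2)) := by
  open CoupledMinMax in
  exact ⟨⟨noSolutionInstance_isValid, fun _ => noSolutionInstance_localRegime,
      fun _ _ h0 h1 h2 _ => noSolutionInstance_not_exists_isLocalMinMax h0 h1 h2,
      fun _ _ h => noSolutionInstance_not_exists_isGDAFixedPoint h⟩,
    ⟨noSolutionQ_isValid, noSolutionQ_hasCircuits, LipschitzWith.const' _,
      noSolutionF_circuitComputable, fun _ _ h => noSolutionQ_not_exists_isQuasiVISolution h⟩,
    fun _ _ _ hR _ hν => PolytopeMap.exists_isKakutaniSolution hR hν,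
    irrationalQ_isValid, irrationalQ_hasCircuits, irrationalQ_isKakutaniSolution_iff,
    irrational_one_div_sqrt_two⟩
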